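/- A residuated lattice is an algebra $(A,\vee,\wedge,\odot,\to,0,1)$ such that $(A,\vee,\wedge,0,1)$ is a bounded lattice, $(A,\odot,1)$ is a commutative monoid, and $a\le b\to c$ iff $a\odot b\le c$. A filter of $A$ is a nonempty up-closed subset closed under $\odot$; $[a)=\{c : a^n\le c \text{ for some } n\in\mathbb N\}$ is the principal filter generated by $a$. A filter $P$ is prime if $P\neq A$ and $x\vee y\in P$ implies $x\in P$ or $y\in P$; maximal filters are the maximal proper filters. For a filter $F$, let $A/F$ be the quotient of $A$ by the congruence $x\sim_F y \Leftrightarrow (x\to y)\wedge(y\to x)\in F$. Let $\mathcal B(M)$ denote the set of complemented elements of a bounded lattice $M$, and $\mathrm{Con}(A)$ the lattice of congruences of $A$. The reticulation functor $\mathcal L$, from residuated lattices to bounded distributive lattices, sends $A$ to the lattice $\mathcal L(A)$ of the classes $\lambda(a)$ of the relation $[a)=[b)$ on $A$, with $\lambda(a)\le\lambda(b)$ iff $[b)\subseteq[a)$, $\lambda(a)\vee\lambda(b)=\lambda(a\vee b)$ and $\lambda(a)\wedge\lambda(b)=\lambda(a\odot b)$ (the dual of the lattice of principal filters of $A$; its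 prime filter spectrum is homeomorphic to that of $A$), and sends a morphism $f$ to $\lambda(a)\mapsto\lambda(f(a))$. Consider the following classes of residuated lattices $A$: 1. Gelfand residuated lattices: every prime filter of $A$ is included in a unique maximal filter of $A$; 2. residuated lattices with BLP: for every filter $F$ of $A$, the map $\mathcal B(A)\to\mathcal B(A/F)$ induced by the canonical surjection is surjective; 3. residuated lattices with CBLP: for every $\theta\in\mathrm{Con}(A)$, the map $\mathcal B(\mathrm{Con}(A))\to\mathcal B(\mathrm{Con}(A/\theta))$, $\alpha\mapsto(\alpha\vee\theta)/\theta$, is surjective; 4. BL-algebras: $x\wedge y=x\odot(x\to y)$ and $(x\to y)\vee(y\to x)=1$ for all $x,y\in A$; 5. MV-algebras: $(x\to y)\to y=(y\to x)\to x$ for all $x,y\in A$. A bounded distributive lattice $L$ is conormal if for all $x,y\in L$ with $x\wedge y=0$ there are $e,f\in L$ with $e\vee f=1$ and $x\wedge e=y\wedge f=0$. **Corollary.** For each of the five classes, the image of the class under $\mathcal L$ (up to isomorphism) is included in the class of conormal bounded distributive lattices, and is not the whole class of bounded distributive lattices. Moreover, classes 2 and 3 coincide: a residuated lattice has BLP if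 and only if it has CBLP. -/

import Mathlib

universe u

open CategoryTheory

/-- A (commutative, bounded, integral) residuated lattice `(A, ∨, ∧, ⊙, →, 0, 1)`: a bounded
lattice with a commutative monoid `(A, ⊙, 1)`, whose unit is the top element, and an
implication `→` (written `⇨`) such that `a ≤ b → c` iff `a ⊙ b ≤ c`. -/
class ResiduatedLattice (A : Type u) extends
    Lattice A, BoundedOrder A, CommMonoid A, HImp A where
  one_eq_top : (1 : A) = ⊤
  le_himp_iff_mul_le : ∀ a b c : A, a ≤ b ⇨ c ↔ a * b ≤ c

namespace ResiduatedLattice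

section Basic

variable {A : Type u} [ResiduatedLattice A]

theorem le_one' (a : A) : a ≤ 1 := by rw [one_eq_top]; exact le_top

instance : IsOrderedMonoid A where
  mul_le_mul_left a b h c :=
    (le_himp_iff_mul_le a c (b * c)).1 (h.trans ((le_himp_iff_mul_le b c (b * c)).2 le_rfl))

theorem mul_le_left (a b : A) : a * b ≤ a := by
  simpa using mul_le_mul_right (le_one' b) a

theorem mul_le_right (a b : A) : a * b ≤ b := by
  simpa using mul_le_mul_left (le_one' a) b

theorem himp_mul_le (a b : A) : (a ⇨ b) * a ≤ b := (le_himp_iff_mul_le _ _ _).1 le_rfl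

theorem mul_sup_le {a b c d : A} (h₁ : d * a ≤ c) (h₂ : d * b ≤ c) : d * (a ⊔ b) ≤ c := by
  rw [mul_comm, ← le_himp_iff_mul_le]
  refine sup_le ?_ ?_ <;> rw [le_himp_iff_mul_le, mul_comm] <;> assumption

theorem sup_mul_sup_le (x y z : A) : (x ⊔ z) * (y ⊔ z) ≤ (x * y) ⊔ z := by
  refine mul_sup_le ?_ ((mul_le_right _ _).trans le_sup_right)
  rw [mul_comm]
  refine mul_sup_le ?_ ((mul_le_right _ _).trans le_sup_right)
  rw [mul_comm]
  exact le_sup_left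

theorem sup_pow_le (a c : A) (n : ℕ) : (a ⊔ c) ^ n ≤ a ^ n ⊔ c := by
  induction n with
  | zero => simp
  | succ n ih =>
    rw [pow_succ, pow_succ]
    exact (mul_le_mul_left ih _).trans (sup_mul_sup_le _ _ _)

end Basic

/-- A filter of `A`: a nonempty upward closed subset which is closed under `⊙`. -/
structure Filt (A : Type u) [ResiduatedLattice A] where
  carrier : Set A
  nonempty : carrier.Nonempty
  mul_mem : ∀ {x y : A}, x ∈ carrier → y ∈ carrier → x * y ∈ carrier
  mem_of_le : ∀ {x y : A}, x ∈ carrier → x ≤ y → y ∈ carrier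

namespace Filt

variable {A : Type u} [ResiduatedLattice A]

instance : SetLike (Filt A) A where
  coe F := F.carrier
  coe_injective F G h := by cases F; cases G; cases h; rfl

/-- Filters are ordered by inclusion. -/
instance : PartialOrder (Filt A) := .ofSetLike (Filt A) A

theorem one_mem (F : Filt A) : (1 : A) ∈ F :=
  F.nonempty.elim fun x hx => F.mem_of_le hx (le_one' x)

theorem pow_mem (F : Filt A) {x : A} (hx : x ∈ F) (n : ℕ) : x ^ n ∈ F := by
  induction n with
  | zero => simpa using F.one_mem
  | succ n ih => rw [pow_succ]; exact F.mul_mem ih hx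

/-- A filter of `A` is proper iff it is not the whole of `A`. -/
def IsProper (F : Filt A) : Prop := ∃ x : A, x ∉ F

/-- A filter `P` is prime iff it is proper and `x ∨ y ∈ P` implies `x ∈ P` or `y ∈ P`. -/
def IsPrime (P : Filt A) : Prop :=
  P.IsProper ∧ ∀ x y : A, x ⊔ y ∈ P → x ∈ P ∨ y ∈ P

/-- A maximal filter is a maximal element of the set of proper filters. -/
def IsMaximal (M : Filt A) : Prop := Maximal IsProper M

/-- The principal filter `[a) = {c | a ^ n ≤ c for some n}`. -/
def principal (a : A) : Filt A where
  carrier := {c | ∃ n : ℕ, a ^ n ≤ c}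
  nonempty := ⟨1, 0, by simp⟩
  mul_mem := by
    rintro x y ⟨n, hn⟩ ⟨m, hm⟩
    exact ⟨n + m, by rw [pow_add]; exact mul_le_mul' hn hm⟩
  mem_of_le := by
    rintro x y ⟨n, hn⟩ h
    exact ⟨n, hn.trans h⟩

theorem mem_principal {a c : A} : c ∈ principal a ↔ ∃ n : ℕ, a ^ n ≤ c := Iff.rfl

theorem self_mem_principal (a : A) : a ∈ principal a := ⟨1, by simp⟩

/-- `[a)` is the smallest filter that contains `a`. -/
theorem principal_le_iff {a : A} {F : Filt A} : principal a ≤ F ↔ a ∈ F :=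
  ⟨fun h => h (self_mem_principal a), fun h _ hc =>
    let ⟨n, hn⟩ := hc
    F.mem_of_le (F.pow_mem h n) hn⟩

theorem principal_le_of_le {a b : A} (h : a ≤ b) : principal b ≤ principal a :=
  principal_le_iff.2 ((principal a).mem_of_le (self_mem_principal a) h)

theorem mem_of_mul_le (F : Filt A) {f x y : A} (hf : f ∈ F) (h : f * x ≤ y) : x ⇨ y ∈ F :=
  F.mem_of_le hf ((le_himp_iff_mul_le _ _ _).2 h)

theorem inf_mem_iff (F : Filt A) {x y : A} : x ⊓ y ∈ F ↔ x ∈ F ∧ y ∈ F :=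
  ⟨fun h => ⟨F.mem_of_le h inf_le_left, F.mem_of_le h inf_le_right⟩,
    fun h => F.mem_of_le (F.mul_mem h.1 h.2) (le_inf (mul_le_left _ _) (mul_le_right _ _))⟩

end Filt

/-- A congruence of `A`: an equivalence relation compatible with `∨`, `∧`, `⊙` and `→`. -/
structure Congr (A : Type u) [ResiduatedLattice A] extends Setoid A where
  sup : ∀ {a b c d : A}, r a b → r c d → r (a ⊔ c) (b ⊔ d)
  inf : ∀ {a b c d : A}, r a b → r c d → r (a ⊓ c) (b ⊓ d)
  mul : ∀ {a b c d : A}, r a b → r c d → r (a * c) (b * d)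
  himp : ∀ {a b c d : A}, r a b → r c d → r (a ⇨ c) (b ⇨ d)

namespace Congr

variable {A : Type u} [ResiduatedLattice A]

theorem ext {θ φ : Congr A} (h : ∀ a b : A, θ.r a b ↔ φ.r a b) : θ = φ := by
  have h' : θ.toSetoid = φ.toSetoid := Setoid.ext h
  cases θ; cases φ; cases h'; rfl

/-- Congruences are ordered by inclusion. -/
instance : PartialOrder (Congr A) where
  le θ φ := ∀ a b : A, θ.r a b → φ.r a b
  le_refl _ _ _ h := h
  le_trans _ _ _ h₁ h₂ a b h := h₂ a b (h₁ a b h)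
  le_antisymm _ _ h₁ h₂ := ext fun a b => ⟨h₁ a b, h₂ a b⟩

/-- The meet of a family of congruences is its intersection. -/
instance : InfSet (Congr A) where
  sInf S :=
    { r := fun a b => ∀ θ ∈ S, θ.r a b
      iseqv := ⟨fun a θ _ => θ.iseqv.refl a, fun h θ hθ => θ.iseqv.symm (h θ hθ),
        fun h₁ h₂ θ hθ => θ.iseqv.trans (h₁ θ hθ) (h₂ θ hθ)⟩
      sup := fun h₁ h₂ θ hθ => θ.sup (h₁ θ hθ) (h₂ θ hθ)
      inf := fun h₁ h₂ θ hθ => θ.inf (h₁ θ hθ) (h₂ θ hθ)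
      mul := fun h₁ h₂ θ hθ => θ.mul (h₁ θ hθ) (h₂ θ hθ)
      himp := fun h₁ h₂ θ hθ => θ.himp (h₁ θ hθ) (h₂ θ hθ) }

/-- The complete lattice `Con(A)` of the congruences of `A`, ordered by inclusion. -/
instance : CompleteLattice (Congr A) :=
  completeLatticeOfInf (Congr A) fun _ =>
    ⟨fun θ hθ _ _ h => h θ hθ, fun _ hφ a b h _ hθ => hφ hθ a b h⟩

/-- The underlying set of the quotient `A/θ`. -/
def Quo (θ : Congr A) : Type u := Quotient θ.toSetoid

/-- The canonical surjection `p_θ : A → A/θ`. -/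
def proj (θ : Congr A) (a : A) : θ.Quo := Quotient.mk θ.toSetoid a

theorem proj_eq_iff (θ : Congr A) {a b : A} : θ.proj a = θ.proj b ↔ θ.r a b :=
  ⟨fun h => Quotient.exact h, fun h => Quotient.sound (s := θ.toSetoid) h⟩

theorem quo_ind (θ : Congr A) {p : θ.Quo → Prop} (h : ∀ a, p (θ.proj a)) (x : θ.Quo) : p x :=
  Quotient.inductionOn x h

instance (θ : Congr A) : Max θ.Quo :=
  ⟨Quotient.map₂ (· ⊔ ·) fun _ _ h₁ _ _ h₂ => θ.sup h₁ h₂⟩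

instance (θ : Congr A) : Min θ.Quo :=
  ⟨Quotient.map₂ (· ⊓ ·) fun _ _ h₁ _ _ h₂ => θ.inf h₁ h₂⟩

instance (θ : Congr A) : Mul θ.Quo :=
  ⟨Quotient.map₂ (· * ·) fun _ _ h₁ _ _ h₂ => θ.mul h₁ h₂⟩

instance (θ : Congr A) : HImp θ.Quo :=
  ⟨Quotient.map₂ (· ⇨ ·) fun _ _ h₁ _ _ h₂ => θ.himp h₁ h₂⟩

instance (θ : Congr A) : Lattice θ.Quo :=
  Lattice.mk'
    (fun x y => by
      induction x using θ.quo_ind; induction y using θ.quo_ind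
      exact congrArg θ.proj (sup_comm _ _))
    (fun x y z => by
      induction x using θ.quo_ind; induction y using θ.quo_ind; induction z using θ.quo_ind
      exact congrArg θ.proj (sup_assoc _ _ _))
    (fun x y => by
      induction x using θ.quo_ind; induction y using θ.quo_ind
      exact congrArg θ.proj (inf_comm _ _))
    (fun x y z => by
      induction x using θ.quo_ind; induction y using θ.quo_ind; induction z using θ.quo_ind
      exact congrArg θ.proj (inf_assoc _ _ _))
    (fun x y => by
      induction x using θ.quo_ind; induction y using θ.quo_ind
      exact congrArg θ.proj sup_inf_self)
    (fun x y => by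
      induction x using θ.quo_ind; induction y using θ.quo_ind
      exact congrArg θ.proj inf_sup_self)

theorem proj_le_iff (θ : Congr A) {a b : A} : θ.proj a ≤ θ.proj b ↔ θ.r (a ⊔ b) b := by
  rw [← sup_eq_right]
  exact θ.proj_eq_iff

theorem proj_le_iff' (θ : Congr A) {a b : A} : θ.proj a ≤ θ.proj b ↔ θ.r (a ⊓ b) a := by
  rw [← inf_eq_left]
  exact θ.proj_eq_iff

theorem proj_mono (θ : Congr A) {a b : A} (h : a ≤ b) : θ.proj a ≤ θ.proj b := by
  rw [proj_le_iff, sup_eq_right.2 h]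

instance (θ : Congr A) : BoundedOrder θ.Quo where
  top := θ.proj ⊤
  bot := θ.proj ⊥
  le_top x := by induction x using θ.quo_ind; exact θ.proj_mono le_top
  bot_le x := by induction x using θ.quo_ind; exact θ.proj_mono bot_le

instance (θ : Congr A) : CommMonoid θ.Quo where
  one := θ.proj 1
  mul_comm x y := by
    induction x using θ.quo_ind; induction y using θ.quo_ind
    exact congrArg θ.proj (mul_comm _ _)
  mul_assoc x y z := by
    induction x using θ.quo_ind; induction y using θ.quo_ind; induction z using θ.quo_ind
    exact congrArg θ.proj (mul_assoc _ _ _)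
  one_mul x := by induction x using θ.quo_ind; exact congrArg θ.proj (one_mul _)
  mul_one x := by induction x using θ.quo_ind; exact congrArg θ.proj (mul_one _)

/-- The quotient residuated lattice `A/θ`, with the operations induced by those of `A`. -/
instance (θ : Congr A) : ResiduatedLattice θ.Quo where
  one_eq_top := congrArg θ.proj one_eq_top
  le_himp_iff_mul_le x y z := by
    induction x using θ.quo_ind with | _ a
    induction y using θ.quo_ind with | _ b
    induction z using θ.quo_ind with | _ c
    change θ.proj a ≤ θ.proj (b ⇨ c) ↔ θ.proj (a * b) ≤ θ.proj c
    constructor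
    · intro h
      rw [proj_le_iff'] at h
      have h₁ : θ.r (((a ⊓ (b ⇨ c)) * b) ⊔ c) ((a * b) ⊔ c) :=
        θ.sup (θ.mul h (θ.iseqv.refl b)) (θ.iseqv.refl c)
      have h₂ : (a ⊓ (b ⇨ c)) * b ≤ c := (le_himp_iff_mul_le _ _ _).1 inf_le_right
      rw [sup_eq_right.2 h₂] at h₁
      exact θ.proj_le_iff.2 (θ.iseqv.symm h₁)
    · intro h
      rw [proj_le_iff] at h
      have h₁ : θ.r (a ⊓ (b ⇨ ((a * b) ⊔ c))) (a ⊓ (b ⇨ c)) :=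
        θ.inf (θ.iseqv.refl a) (θ.himp (θ.iseqv.refl b) h)
      have h₂ : a ≤ b ⇨ ((a * b) ⊔ c) := (le_himp_iff_mul_le _ _ _).2 le_sup_left
      rw [inf_eq_left.2 h₂] at h₁
      exact θ.proj_le_iff'.2 (θ.iseqv.symm h₁)

/-- For congruences `θ ⊆ φ` of `A`, the congruence `φ/θ = {(a/θ, b/θ) | (a, b) ∈ φ}` of `A/θ`. -/
def quo (θ φ : Congr A) (h : θ ≤ φ) : Congr θ.Quo where
  r x y := ∃ a b : A, θ.proj a = x ∧ θ.proj b = y ∧ φ.r a b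
  iseqv := by
    refine ⟨fun x => ?_, ?_, ?_⟩
    · induction x using θ.quo_ind with | _ a
      exact ⟨a, a, rfl, rfl, φ.iseqv.refl a⟩
    · rintro x y ⟨a, b, ha, hb, hab⟩
      exact ⟨b, a, hb, ha, φ.iseqv.symm hab⟩
    · rintro x y z ⟨a, b, ha, hb, hab⟩ ⟨c, d, hc, hd, hcd⟩
      have hbc : φ.r b c := h b c (θ.proj_eq_iff.1 (hb.trans hc.symm))
      exact ⟨a, d, ha, hd, φ.iseqv.trans hab (φ.iseqv.trans hbc hcd)⟩
  sup := by
    rintro x y z w ⟨a, b, rfl, rfl, hab⟩ ⟨c, d, rfl, rfl, hcd⟩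
    exact ⟨a ⊔ c, b ⊔ d, rfl, rfl, φ.sup hab hcd⟩
  inf := by
    rintro x y z w ⟨a, b, rfl, rfl, hab⟩ ⟨c, d, rfl, rfl, hcd⟩
    exact ⟨a ⊓ c, b ⊓ d, rfl, rfl, φ.inf hab hcd⟩
  mul := by
    rintro x y z w ⟨a, b, rfl, rfl, hab⟩ ⟨c, d, rfl, rfl, hcd⟩
    exact ⟨a * c, b * d, rfl, rfl, φ.mul hab hcd⟩
  himp := by
    rintro x y z w ⟨a, b, rfl, rfl, hab⟩ ⟨c, d, rfl, rfl, hcd⟩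
    exact ⟨a ⇨ c, b ⇨ d, rfl, rfl, φ.himp hab hcd⟩

/-- The map `u_θ : Con(A) → Con(A/θ)`, `u_θ(α) = (α ∨ θ)/θ`. -/
def u (θ α : Congr A) : Congr θ.Quo := quo θ (α ⊔ θ) le_sup_right

/-- A congruence `θ` of `A` has the Congruence Boolean Lifting Property iff `u_θ` maps the
complemented elements of `Con(A)` onto the complemented elements of `Con(A/θ)`. -/
def HasCBLP (θ : Congr A) : Prop :=
  ∀ γ : Congr θ.Quo, IsComplemented γ → ∃ α : Congr A, IsComplemented α ∧ θ.u α = γ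

end Congr

/-- The congruence `∼_F` associated to a filter `F`: `x ∼_F y` iff
`x ↔ y = (x → y) ∧ (y → x)` belongs to `F`. -/
def Filt.congr {A : Type u} [ResiduatedLattice A] (F : Filt A) : Congr A where
  r x y := (x ⇨ y) ⊓ (y ⇨ x) ∈ F
  iseqv := by
    refine ⟨fun x => ?_, fun {x y} h => ?_, fun {x y z} h₁ h₂ => ?_⟩
    · exact F.inf_mem_iff.2 ⟨F.mem_of_mul_le F.one_mem (by simp),
        F.mem_of_mul_le F.one_mem (by simp)⟩
    · rwa [inf_comm]
    · rw [F.inf_mem_iff] at h₁ h₂ ⊢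
      refine ⟨F.mem_of_mul_le (F.mul_mem h₂.1 h₁.1) ?_,
        F.mem_of_mul_le (F.mul_mem h₁.2 h₂.2) ?_⟩
      · rw [mul_assoc]
        exact (mul_le_mul_right (himp_mul_le _ _) _).trans (himp_mul_le _ _)
      · rw [mul_assoc]
        exact (mul_le_mul_right (himp_mul_le _ _) _).trans (himp_mul_le _ _)
  sup := by
    have key : ∀ a b c d : A, a ⇨ b ∈ F → c ⇨ d ∈ F → (a ⊔ c) ⇨ (b ⊔ d) ∈ F := by
      intro a b c d h₁ h₂
      refine F.mem_of_mul_le (F.mul_mem h₁ h₂) (mul_sup_le ?_ ?_)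
      · exact (mul_le_mul_left (mul_le_left _ _) _).trans ((himp_mul_le _ _).trans le_sup_left)
      · exact (mul_le_mul_left (mul_le_right _ _) _).trans ((himp_mul_le _ _).trans le_sup_right)
    intro a b c d h₁ h₂
    rw [F.inf_mem_iff] at h₁ h₂ ⊢
    exact ⟨key _ _ _ _ h₁.1 h₂.1, key _ _ _ _ h₁.2 h₂.2⟩
  inf := by
    have key : ∀ a b c d : A, a ⇨ b ∈ F → c ⇨ d ∈ F → (a ⊓ c) ⇨ (b ⊓ d) ∈ F := by
      intro a b c d h₁ h₂
      refine F.mem_of_mul_le (F.mul_mem h₁ h₂) (le_inf ?_ ?_)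
      · exact (mul_le_mul' (mul_le_left _ _) inf_le_left).trans (himp_mul_le _ _)
      · exact (mul_le_mul' (mul_le_right _ _) inf_le_right).trans (himp_mul_le _ _)
    intro a b c d h₁ h₂
    rw [F.inf_mem_iff] at h₁ h₂ ⊢
    exact ⟨key _ _ _ _ h₁.1 h₂.1, key _ _ _ _ h₁.2 h₂.2⟩
  mul := by
    have key : ∀ a b c d : A, a ⇨ b ∈ F → c ⇨ d ∈ F → (a * c) ⇨ (b * d) ∈ F := by
      intro a b c d h₁ h₂
      refine F.mem_of_mul_le (F.mul_mem h₁ h₂) ?_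
      rw [mul_mul_mul_comm]
      exact mul_le_mul' (himp_mul_le _ _) (himp_mul_le _ _)
    intro a b c d h₁ h₂
    rw [F.inf_mem_iff] at h₁ h₂ ⊢
    exact ⟨key _ _ _ _ h₁.1 h₂.1, key _ _ _ _ h₁.2 h₂.2⟩
  himp := by
    have key : ∀ a b c d : A, b ⇨ a ∈ F → c ⇨ d ∈ F → (a ⇨ c) ⇨ (b ⇨ d) ∈ F := by
      intro a b c d h₁ h₂
      refine F.mem_of_mul_le (F.mul_mem h₂ h₁) ((le_himp_iff_mul_le _ _ _).2 ?_)
      calc (c ⇨ d) * (b ⇨ a) * (a ⇨ c) * b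
          = (c ⇨ d) * ((a ⇨ c) * ((b ⇨ a) * b)) := by
            rw [mul_assoc, mul_assoc, mul_left_comm (b ⇨ a)]
        _ ≤ (c ⇨ d) * ((a ⇨ c) * a) := by gcongr; exact himp_mul_le _ _
        _ ≤ (c ⇨ d) * c := by gcongr; exact himp_mul_le _ _
        _ ≤ d := himp_mul_le _ _
    intro a b c d h₁ h₂
    rw [F.inf_mem_iff] at h₁ h₂ ⊢
    exact ⟨key _ _ _ _ h₁.2 h₂.1, key _ _ _ _ h₁.1 h₂.2⟩

/-- A filter `F` of `A` has the Boolean Lifting Property iff the canonical surjection `A → A/F`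
maps the Boolean center (the set of complemented elements) of `A` onto that of `A/F`. -/
def Filt.HasBLP {A : Type u} [ResiduatedLattice A] (F : Filt A) : Prop :=
  ∀ y : F.congr.Quo, IsComplemented y → ∃ x : A, IsComplemented x ∧ F.congr.proj x = y

section Classes

variable (A : Type u) [ResiduatedLattice A]

/-- `A` has the Boolean Lifting Property iff each of its filters does. -/
def HasBLP : Prop := ∀ F : Filt A, F.HasBLP

/-- `A` has the Congruence Boolean Lifting Property iff each of its congruences does. -/
def HasCBLP : Prop := ∀ θ : Congr A, θ.HasCBLP

/-- `A` is Gelfand iff every prime filter is included in a unique maximal filter. -/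
def IsGelfand : Prop :=
  ∀ P : Filt A, P.IsPrime → ∃! M : Filt A, M.IsMaximal ∧ P ≤ M

/-- BL-algebras: the residuated lattices that are divisible, `x ∧ y = x ⊙ (x → y)`, and
prelinear, `(x → y) ∨ (y → x) = 1`. -/
def IsBLAlgebra : Prop :=
  (∀ x y : A, x ⊓ y = x * (x ⇨ y)) ∧ ∀ x y : A, (x ⇨ y) ⊔ (y ⇨ x) = 1

/-- MV-algebras, as residuated lattices: those which satisfy `(x → y) → y = (y → x) → x`.
With `¬ x = x → 0` and `x ⊕ y = ¬ x → y` this is Chang's axiom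
`¬ (¬ x ⊕ y) ⊕ y = ¬ (¬ y ⊕ x) ⊕ x`, and for `y = 0` it is `¬ ¬ x = x`. -/
def IsMVAlgebra : Prop := ∀ x y : A, (x ⇨ y) ⇨ y = (y ⇨ x) ⇨ x

end Classes

section Reticulation

variable (A : Type u) [ResiduatedLattice A]

/-- The equivalence relation `a ≡ b` iff `[a) = [b)`. -/
def reticulationSetoid : Setoid A := Setoid.ker (Filt.principal (A := A))

/-- The underlying set of the reticulation of `A`: the quotient of `A` by `[a) = [b)`. -/
def Reticulation : Type u := Quotient (reticulationSetoid A)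

variable {A}

/-- The canonical surjection `A → L(A)`. -/
def toRet (a : A) : Reticulation A := Quotient.mk (reticulationSetoid A) a

theorem ret_ind {p : Reticulation A → Prop} (h : ∀ a, p (toRet a)) (x : Reticulation A) : p x :=
  Quotient.inductionOn x h

theorem toRet_eq_iff {a b : A} : toRet a = toRet b ↔ Filt.principal a = Filt.principal b :=
  ⟨fun h => Quotient.exact h, fun h => Quotient.sound (s := reticulationSetoid A) h⟩

/-- The principal filter `[a)` as a function of the class of `a`. -/
def retPrincipal : Reticulation A → Filt A := Quotient.lift Filt.principal fun _ _ h => h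

theorem retPrincipal_injective : Function.Injective (retPrincipal (A := A)) := by
  intro x y h
  induction x using ret_ind; induction y using ret_ind
  exact toRet_eq_iff.2 h

/-- The order of `L(A)` is dual to the inclusion of principal filters. -/
instance : PartialOrder (Reticulation A) where
  le x y := retPrincipal y ≤ retPrincipal x
  le_refl x := le_refl (retPrincipal x)
  le_trans x y z h₁ h₂ := le_trans (a := retPrincipal z) h₂ h₁
  le_antisymm _ _ h₁ h₂ := retPrincipal_injective (le_antisymm h₂ h₁)

theorem toRet_le_iff {a b : A} : toRet a ≤ toRet b ↔ ∃ n : ℕ, a ^ n ≤ b :=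
  Filt.principal_le_iff

theorem toRet_mono {a b : A} (h : a ≤ b) : toRet a ≤ toRet b := Filt.principal_le_of_le h

theorem toRet_sup_le {a b c : A} (h₁ : toRet a ≤ toRet c) (h₂ : toRet b ≤ toRet c) :
    toRet (a ⊔ b) ≤ toRet c := by
  rw [toRet_le_iff] at *
  obtain ⟨n, hn⟩ := h₁
  obtain ⟨m, hm⟩ := h₂
  refine ⟨n * m, ?_⟩
  rw [pow_mul]
  calc ((a ⊔ b) ^ n) ^ m ≤ (b ⊔ c) ^ m := by
        refine pow_le_pow_left' ((sup_pow_le a b n).trans ?_) m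
        exact sup_le (hn.trans le_sup_right) le_sup_left
    _ ≤ b ^ m ⊔ c := sup_pow_le b c m
    _ ≤ c := sup_le hm le_rfl

theorem le_toRet_mul {a b c : A} (h₁ : toRet c ≤ toRet a) (h₂ : toRet c ≤ toRet b) :
    toRet c ≤ toRet (a * b) :=
  Filt.principal_le_iff.2
    ((Filt.principal c).mul_mem (Filt.principal_le_iff.1 h₁) (Filt.principal_le_iff.1 h₂))

/-- The lattice structure of the reticulation: the join of the classes of `a` and `b` is the class
of `a ∨ b`, and their meet is the class of `a ⊙ b`. -/
instance : DistribLattice (Reticulation A) where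
  sup := Quotient.map₂ (· ⊔ ·) fun a a' h₁ b b' h₂ => by
    have h₁ : toRet a = toRet a' := toRet_eq_iff.2 h₁
    have h₂ : toRet b = toRet b' := toRet_eq_iff.2 h₂
    refine toRet_eq_iff.1 (le_antisymm (toRet_sup_le ?_ ?_) (toRet_sup_le ?_ ?_))
    · rw [h₁]; exact toRet_mono le_sup_left
    · rw [h₂]; exact toRet_mono le_sup_right
    · rw [← h₁]; exact toRet_mono le_sup_left
    · rw [← h₂]; exact toRet_mono le_sup_right
  inf := Quotient.map₂ (· * ·) fun a a' h₁ b b' h₂ => by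
    have h₁ : toRet a = toRet a' := toRet_eq_iff.2 h₁
    have h₂ : toRet b = toRet b' := toRet_eq_iff.2 h₂
    refine toRet_eq_iff.1 (le_antisymm (le_toRet_mul ?_ ?_) (le_toRet_mul ?_ ?_))
    · rw [← h₁]; exact toRet_mono (mul_le_left _ _)
    · rw [← h₂]; exact toRet_mono (mul_le_right _ _)
    · rw [h₁]; exact toRet_mono (mul_le_left _ _)
    · rw [h₂]; exact toRet_mono (mul_le_right _ _)
  le_sup_left x y := by
    induction x using ret_ind; induction y using ret_ind
    exact toRet_mono le_sup_left
  le_sup_right x y := by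
    induction x using ret_ind; induction y using ret_ind
    exact toRet_mono le_sup_right
  sup_le x y z := by
    induction x using ret_ind; induction y using ret_ind; induction z using ret_ind
    exact toRet_sup_le
  inf_le_left x y := by
    induction x using ret_ind; induction y using ret_ind
    exact toRet_mono (mul_le_left _ _)
  inf_le_right x y := by
    induction x using ret_ind; induction y using ret_ind
    exact toRet_mono (mul_le_right _ _)
  le_inf x y z := by
    induction x using ret_ind; induction y using ret_ind; induction z using ret_ind
    exact le_toRet_mul
  le_sup_inf x y z := by
    induction x using ret_ind with | _ a
    induction y using ret_ind with | _ b
    induction z using ret_ind with | _ c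
    refine toRet_mono (a := (a ⊔ b) * (a ⊔ c)) (b := a ⊔ (b * c)) ?_
    rw [sup_comm a b, sup_comm a c, sup_comm a (b * c)]
    exact sup_mul_sup_le b c a

instance : BoundedOrder (Reticulation A) where
  top := toRet 1
  bot := toRet ⊥
  le_top x := by induction x using ret_ind; exact toRet_mono (le_one' _)
  bot_le x := by induction x using ret_ind; exact toRet_mono bot_le

theorem toRet_sup (a b : A) : toRet (a ⊔ b) = toRet a ⊔ toRet b := rfl

theorem toRet_mul (a b : A) : toRet (a * b) = toRet a ⊓ toRet b := rfl

end Reticulation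

section Spectra

/-- The prime spectrum of `A`: the set of its prime filters. -/
def PrimeSpec (A : Type u) [ResiduatedLattice A] : Type u := {P : Filt A // P.IsPrime}

/-- The Stone topology on the prime filters of `A`, generated by the sets `{P | a ∉ P}`. -/
instance (A : Type u) [ResiduatedLattice A] : TopologicalSpace (PrimeSpec A) :=
  .generateFrom (Set.range fun a : A => {P : PrimeSpec A | a ∉ P.1})

/-- The prime spectrum of a bounded distributive lattice: the set of its prime filters. -/
def LatPrimeSpec (L : Type u) [DistribLattice L] : Type u :=
  {P : Order.PFilter L // P.IsPrime}

/-- The Stone topology on the prime filters of `L`, generated by the sets `{P | x ∉ P}`. -/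
instance (L : Type u) [DistribLattice L] : TopologicalSpace (LatPrimeSpec L) :=
  .generateFrom (Set.range fun x : L => {P : LatPrimeSpec L | x ∉ P.1})

/-- The prime filter `{a | [a] ∈ P}` of `A` for a prime filter `P` of `L(A)`. -/
def primeOfRet {A : Type u} [ResiduatedLattice A] (P : LatPrimeSpec (Reticulation A)) :
    PrimeSpec A :=
  ⟨{ carrier := {a | toRet a ∈ P.1}
     nonempty := ⟨1, Order.PFilter.top_mem (F := P.1)⟩
     mul_mem := fun {x y} hx hy =>
       Order.PFilter.inf_mem (F := P.1) (x := toRet x) (y := toRet y) hx hy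
     mem_of_le := fun {x y} hx h =>
       Order.PFilter.mem_of_le (F := P.1) (x := toRet x) (y := toRet y) (toRet_mono h) hx }, by
    constructor
    · obtain ⟨x, hx⟩ := P.2.compl_ideal.Nonempty
      induction x using ret_ind with | _ a
      exact ⟨a, hx⟩
    · intro a b h
      by_contra hn
      rw [not_or] at hn
      obtain ⟨z, hz, h₁, h₂⟩ := P.2.compl_ideal.Directed _ hn.1 _ hn.2
      exact hz (Order.PFilter.mem_of_le (sup_le h₁ h₂ : toRet a ⊔ toRet b ≤ z) h)⟩

/-- The filter `{[a] | a ∈ F}` of `L(A)` for a filter `F` of `A`. -/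
def retFilter {A : Type u} [ResiduatedLattice A] (F : Filt A) :
    Order.PFilter (Reticulation A) :=
  Order.IsPFilter.toPFilter (F := {x : Reticulation A | retPrincipal x ≤ F})
    (Order.IsPFilter.of_def ⟨toRet 1, Filt.principal_le_iff.2 F.one_mem⟩
      (by
        intro x hx y hy
        induction x using ret_ind with | _ a
        induction y using ret_ind with | _ b
        exact ⟨toRet (a * b), Filt.principal_le_iff.2
          (F.mul_mem (Filt.principal_le_iff.1 hx) (Filt.principal_le_iff.1 hy)),
          toRet_mono (mul_le_left a b), toRet_mono (mul_le_right a b)⟩)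
      (fun {x _} h hx => le_trans (a := retPrincipal _) (b := retPrincipal x) h hx))

theorem toRet_mem_retFilter {A : Type u} [ResiduatedLattice A] {F : Filt A} {a : A} :
    toRet a ∈ retFilter F ↔ a ∈ F :=
  Filt.principal_le_iff (a := a) (F := F)

/-- The prime filter `{[a] | a ∈ P}` of `L(A)` for a prime filter `P` of `A`. -/
def retOfPrime {A : Type u} [ResiduatedLattice A] (P : PrimeSpec A) :
    LatPrimeSpec (Reticulation A) :=
  ⟨retFilter P.1,
    ⟨⟨fun _ _ h hx hy => hx (Order.PFilter.mem_of_le h hy), by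
        obtain ⟨a, ha⟩ := P.2.1
        exact ⟨toRet a, fun h => ha (toRet_mem_retFilter.1 h)⟩,
      by
        intro x hx y hy
        induction x using ret_ind with | _ a
        induction y using ret_ind with | _ b
        refine ⟨toRet (a ⊔ b), fun h => ?_, toRet_mono le_sup_left, toRet_mono le_sup_right⟩
        rcases P.2.2 a b (toRet_mem_retFilter.1 h) with h | h
        · exact hx (toRet_mem_retFilter.2 h)
        · exact hy (toRet_mem_retFilter.2 h)⟩⟩⟩

theorem toRet_mem_retOfPrime {A : Type u} [ResiduatedLattice A] {P : PrimeSpec A} {a : A} :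
    toRet a ∈ (retOfPrime P).1 ↔ a ∈ P.1 :=
  toRet_mem_retFilter

/-- The prime spectra of `L(A)` and `A` are homeomorphic, so that `L(A)` is the reticulation. -/
def reticulationSpecHomeo (A : Type u) [ResiduatedLattice A] :
    LatPrimeSpec (Reticulation A) ≃ₜ PrimeSpec A where
  toFun := primeOfRet
  invFun := retOfPrime
  left_inv P := by
    refine Subtype.ext (SetLike.ext fun x => ?_)
    induction x using ret_ind with | _ a
    exact toRet_mem_retOfPrime
  right_inv P := Subtype.ext (SetLike.ext fun _ => toRet_mem_retOfPrime)
  continuous_toFun := continuous_generateFrom_iff.2 <| by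
    rintro _ ⟨a, rfl⟩
    exact TopologicalSpace.isOpen_generateFrom_of_mem ⟨toRet a, rfl⟩
  continuous_invFun := continuous_generateFrom_iff.2 <| by
    rintro _ ⟨x, rfl⟩
    induction x using ret_ind with | _ a
    refine TopologicalSpace.isOpen_generateFrom_of_mem ⟨a, ?_⟩
    ext P
    exact not_congr toRet_mem_retOfPrime.symm

end Spectra

/-- Morphisms of residuated lattices: the maps that preserve `∨`, `∧`, `⊙`, `→`, `0` and `1`. -/
structure Hom (A B : Type u) [ResiduatedLattice A] [ResiduatedLattice B] where
  toFun : A → B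
  map_sup : ∀ a b : A, toFun (a ⊔ b) = toFun a ⊔ toFun b
  map_inf : ∀ a b : A, toFun (a ⊓ b) = toFun a ⊓ toFun b
  map_mul : ∀ a b : A, toFun (a * b) = toFun a * toFun b
  map_himp : ∀ a b : A, toFun (a ⇨ b) = toFun a ⇨ toFun b
  map_bot : toFun ⊥ = ⊥
  map_one : toFun 1 = 1

namespace Hom

variable {A B : Type u} [ResiduatedLattice A] [ResiduatedLattice B]

theorem ext {f g : Hom A B} (h : f.toFun = g.toFun) : f = g := by
  cases f; cases g; cases h; rfl

theorem map_pow (f : Hom A B) (a : A) (n : ℕ) : f.toFun (a ^ n) = f.toFun a ^ n := by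
  induction n with
  | zero => simpa using f.map_one
  | succ n ih => rw [pow_succ, f.map_mul, ih, pow_succ]

theorem map_mono (f : Hom A B) {a b : A} (h : a ≤ b) : f.toFun a ≤ f.toFun b := by
  rw [← sup_eq_right, ← f.map_sup, sup_eq_right.2 h]

theorem toRet_map_le (f : Hom A B) {a b : A} (h : toRet a ≤ toRet b) :
    toRet (f.toFun a) ≤ toRet (f.toFun b) := by
  rw [toRet_le_iff] at *
  obtain ⟨n, hn⟩ := h
  exact ⟨n, by rw [← f.map_pow]; exact f.map_mono hn⟩

/-- The bounded lattice morphism `L(f) : L(A) → L(B)`, which sends the class of `a` to the class of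
`f(a)`. -/
def retMap (f : Hom A B) : BoundedLatticeHom (Reticulation A) (Reticulation B) where
  toFun := Quotient.map f.toFun fun a b h => by
    have h : toRet a = toRet b := toRet_eq_iff.2 h
    exact toRet_eq_iff.1 (le_antisymm (f.toRet_map_le h.le) (f.toRet_map_le h.ge))
  map_sup' x y := by
    induction x using ret_ind; induction y using ret_ind
    exact congrArg toRet (f.map_sup _ _)
  map_inf' x y := by
    induction x using ret_ind; induction y using ret_ind
    exact congrArg toRet (f.map_mul _ _)
  map_top' := congrArg toRet f.map_one
  map_bot' := congrArg toRet f.map_bot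

end Hom

end ResiduatedLattice

/-- The category of residuated lattices. -/
structure ResLat : Type (u + 1) where
  carrier : Type u
  [str : ResiduatedLattice carrier]

namespace ResLat

open ResiduatedLattice

attribute [instance] ResLat.str

instance : CoeSort ResLat.{u} (Type u) := ⟨ResLat.carrier⟩

instance : Category ResLat.{u} where
  Hom A B := ResiduatedLattice.Hom A B
  id A := ⟨id, fun _ _ => rfl, fun _ _ => rfl, fun _ _ => rfl, fun _ _ => rfl, rfl, rfl⟩
  comp f g :=
    { toFun := g.toFun ∘ f.toFun
      map_sup := fun a b => by simp [f.map_sup, g.map_sup]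
      map_inf := fun a b => by simp [f.map_inf, g.map_inf]
      map_mul := fun a b => by simp [f.map_mul, g.map_mul]
      map_himp := fun a b => by simp [f.map_himp, g.map_himp]
      map_bot := by simp [f.map_bot, g.map_bot]
      map_one := by simp [f.map_one, g.map_one] }

/-- The reticulation functor from residuated lattices to bounded distributive lattices. -/
def reticulation : ResLat.{u} ⥤ BddDistLat.{u} where
  obj A := BddDistLat.of (Reticulation A)
  map f := BddDistLat.ofHom (Hom.retMap f)
  map_id A := by
    ext x
    induction x using ret_ind
    rfl
  map_comp f g := by
    ext x
    induction x using ret_ind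
    rfl

/-- The class of Gelfand residuated lattices. -/
def gelfand : ObjectProperty ResLat.{u} := fun A => IsGelfand A

/-- The class of residuated lattices with the Boolean Lifting Property. -/
def blp : ObjectProperty ResLat.{u} := fun A => HasBLP A

/-- The class of residuated lattices with the Congruence Boolean Lifting Property. -/
def cblp : ObjectProperty ResLat.{u} := fun A => HasCBLP A

/-- The class of BL-algebras. -/
def blAlgebra : ObjectProperty ResLat.{u} := fun A => IsBLAlgebra A

/-- The class of MV-algebras. -/
def mvAlgebra : ObjectProperty ResLat.{u} := fun A => IsMVAlgebra A

end ResLat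

/-- A bounded lattice is normal iff `x ∨ y = 1` implies that there are `e`, `f` with `e ∧ f = 0` and
`x ∨ e = y ∨ f = 1`. -/
def IsNormalLattice (L : Type u) [Lattice L] [BoundedOrder L] : Prop :=
  ∀ x y : L, x ⊔ y = ⊤ → ∃ e f : L, e ⊓ f = ⊥ ∧ x ⊔ e = ⊤ ∧ y ⊔ f = ⊤

/-- A bounded lattice is conormal iff its dual is normal. -/
def IsConormalLattice (L : Type u) [Lattice L] [BoundedOrder L] : Prop :=
  IsNormalLattice Lᵒᵈ

/-- The class of conormal bounded distributive lattices. -/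
def conormalBddDistLat : ObjectProperty BddDistLat.{u} := fun L => IsConormalLattice L

/-! In `Reticulation A` a product `a * b` becomes a meet, so `toRet a ⊓ toRet b = ⊥` says that `a *
b` is nilpotent. Each class supplies the witnesses of conormality differently. BL- and MV-algebras:
prelinearity suffices. The classes of `a ⇨ b` and `b ⇨ a` join to the top, and modus ponens puts
`toRet a ⊓ toRet (a ⇨ b)` below `toRet a ⊓ toRet b`. BLP: after passing to powers, `a * b = ⊥`, so
`a` and `b` become complementary modulo `[a ⊔ b)`. A complemented lift of `a`, together with its
complement, gives the witnesses. Gelfand: if there were no witnesses, the annihilators of `x` and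
`y` would generate a proper ideal. The complement of a prime ideal above it is a prime filter,
compatible with `x` and with `y` separately. Its unique maximal filter would contain both, hence a
nilpotent product. CBLP is equivalent to BLP: congruences correspond to filters, and sending `e` to
the congruence generated by `(e, 1)` is a bijection from the complemented elements of `A` to those
of `Con(A)`, compatible with passing to `A/θ`. No image is everything, because a four-element
Boolean algebra with a new top adjoined is not conormal. -/

namespace ResiduatedLattice

/-! ### Complemented elements and implication in residuated lattices. -/

section Elementary

variable {A : Type u} [ResiduatedLattice A]

/-- Since `*` distributes over joins, an inequality may be tested on each part of a cover of `1`. -/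
theorem le_of_sup_eq_one {a b c x : A} (h : a ⊔ b = 1) (ha : x * a ≤ c) (hb : x * b ≤ c) :
    x ≤ c := by
  simpa [h] using mul_sup_le ha hb

theorem eq_one_of_one_le {a : A} (h : 1 ≤ a) : a = 1 := le_antisymm (le_one' a) h

/-- Multiplying `a ⊓ b` by `a` or by `b` lands below `a * b`. Complements can thus be recognised by
products, which behave better than meets under powers and in filters. -/
theorem isCompl_of_mul_eq_bot {a b : A} (h : a ⊔ b = 1) (hm : a * b = ⊥) : IsCompl a b := by
  refine ⟨disjoint_iff_inf_le.2 (le_of_sup_eq_one h ?_ ?_), codisjoint_iff.2 (h.trans one_eq_top)⟩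
  · rw [← hm, mul_comm]
    exact mul_le_mul_right inf_le_right a
  · rw [← hm]
    exact mul_le_mul_left inf_le_left b

theorem _root_.IsCompl.sup_eq_one {a b : A} (h : IsCompl a b) : a ⊔ b = 1 :=
  h.sup_eq_top.trans one_eq_top.symm

theorem _root_.IsCompl.mul_eq_bot {a b : A} (h : IsCompl a b) : a * b = ⊥ :=
  le_bot_iff.1 ((le_inf (mul_le_left a b) (mul_le_right a b)).trans h.inf_eq_bot.le)

/-- Complemented elements are idempotent, so the filter they generate is just their up-set. -/
theorem _root_.IsComplemented.le_pow {e : A} (h : IsComplemented e) (n : ℕ) : e ≤ e ^ n := by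
  obtain ⟨f, hf⟩ := h
  induction n with
  | zero => simpa using le_one' e
  | succ n ih =>
    rw [pow_succ]
    refine le_of_sup_eq_one hf.sup_eq_one (mul_le_mul_left ih e) ?_
    rw [hf.mul_eq_bot]
    exact bot_le

theorem Filt.mem_principal_iff_of_isComplemented {e c : A} (h : IsComplemented e) :
    c ∈ Filt.principal e ↔ e ≤ c :=
  ⟨fun ⟨n, hn⟩ => (h.le_pow n).trans hn, fun hc => ⟨1, by simpa using hc⟩⟩

theorem one_himp (a : A) : 1 ⇨ a = a :=
  le_antisymm (by simpa using himp_mul_le 1 a) ((le_himp_iff_mul_le _ _ _).2 (by simp))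

theorem himp_eq_one_iff {a b : A} : a ⇨ b = 1 ↔ a ≤ b := by
  rw [← one_mul a, ← le_himp_iff_mul_le, one_mul]
  exact ⟨fun h => h.ge, eq_one_of_one_le⟩

theorem himp_le_himp_right {a b : A} (h : a ≤ b) (c : A) : b ⇨ c ≤ a ⇨ c :=
  (le_himp_iff_mul_le _ _ _).2 ((mul_le_mul_right h _).trans (himp_mul_le b c))

theorem mul_himp (a b c : A) : (a * b) ⇨ c = a ⇨ (b ⇨ c) :=
  eq_of_forall_le_iff fun x => by simp only [le_himp_iff_mul_le, mul_assoc]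

end Elementary

/-! ### Prelinearity of MV-algebras. -/

namespace IsMVAlgebra

variable {A : Type u} [ResiduatedLattice A]

theorem sup_eq (hA : IsMVAlgebra A) (x y : A) : x ⊔ y = (x ⇨ y) ⇨ y := by
  refine le_antisymm (sup_le ?_ ?_) ?_
  · rw [le_himp_iff_mul_le, mul_comm]
    exact himp_mul_le x y
  · rw [le_himp_iff_mul_le]
    exact mul_le_left _ _
  · calc (x ⇨ y) ⇨ y ≤ ((x ⊔ y) ⇨ y) ⇨ y :=
          himp_le_himp_right (himp_le_himp_right le_sup_left y) y
      -- The MV axiom is applied to the comparable pair `x ⊔ y`, `y`, where one implication is `1`.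
      _ = (y ⇨ (x ⊔ y)) ⇨ (x ⊔ y) := hA _ _
      _ = x ⊔ y := by rw [himp_eq_one_iff.2 le_sup_right, one_himp]

theorem himp_bot_himp_bot (hA : IsMVAlgebra A) (x : A) : (x ⇨ ⊥) ⇨ ⊥ = x := by
  rw [← hA.sup_eq, sup_bot_eq]

theorem himp_eq (hA : IsMVAlgebra A) (x y : A) : x ⇨ y = (x * (y ⇨ ⊥)) ⇨ ⊥ := by
  rw [mul_himp, hA.himp_bot_himp_bot]

/-- The nontrivial half of divisibility for a comparable pair. The negation of the right side is the
join of the negations of `y` and `w`, which is that of `y`; double negation then concludes. -/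
theorem le_mul_himp (hA : IsMVAlgebra A) {w y : A} (h : y ≤ w) : y ≤ w * (w ⇨ y) := by
  have key : (w * (w ⇨ y)) ⇨ ⊥ ≤ y ⇨ ⊥ := by
    calc (w * (w ⇨ y)) ⇨ ⊥ = ((y ⇨ ⊥) ⇨ (w ⇨ ⊥)) ⇨ (w ⇨ ⊥) := by
          rw [mul_comm, mul_himp, hA.himp_eq w y, mul_comm w, mul_himp]
      _ = (y ⇨ ⊥) ⊔ (w ⇨ ⊥) := (hA.sup_eq _ _).symm
      _ ≤ y ⇨ ⊥ := sup_le le_rfl (himp_le_himp_right h ⊥)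
  simpa only [hA.himp_bot_himp_bot] using himp_le_himp_right key ⊥

theorem prelinear (hA : IsMVAlgebra A) (x y : A) : (x ⇨ y) ⊔ (y ⇨ x) = 1 := by
  have hy : y ≤ x ⇨ y := (le_himp_iff_mul_le _ _ _).2 (mul_le_left _ _)
  -- Divisibility gives `y ≤ (x ⇨ y) * (x ⊔ y)`, and multiplying by `x ⇨ ⊥` kills the `x` in the
  -- join. As `y ⇨ x` is the negation of `y * (x ⇨ ⊥)`, negating this inequality is what remains of
  -- the goal.
  have key : y * (x ⇨ ⊥) ≤ (x ⇨ y) * (y * (x ⇨ ⊥)) := by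
    calc y * (x ⇨ ⊥) ≤ ((x ⇨ y) * (x ⊔ y)) * (x ⇨ ⊥) := by
          rw [hA.sup_eq x y]
          exact mul_le_mul_left (hA.le_mul_himp hy) _
      _ = (x ⇨ y) * ((x ⇨ ⊥) * (x ⊔ y)) := by rw [mul_assoc, mul_comm (x ⊔ y)]
      _ ≤ (x ⇨ y) * (y * (x ⇨ ⊥)) := mul_le_mul_right
          (mul_sup_le ((himp_mul_le x ⊥).trans bot_le) (mul_comm _ _).le) _
  rw [hA.sup_eq, himp_eq_one_iff, hA.himp_eq y x, ← mul_himp]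
  exact himp_le_himp_right key ⊥

end IsMVAlgebra

/-! ### Joins of filters and existence of maximal filters. -/

namespace Filt

variable {A : Type u} [ResiduatedLattice A]

/-- The filter generated by the union of two filters. -/
def join (F G : Filt A) : Filt A where
  carrier := {c | ∃ f ∈ F, ∃ g ∈ G, f * g ≤ c}
  nonempty := ⟨1, 1, F.one_mem, 1, G.one_mem, le_one' _⟩
  mul_mem := by
    rintro x y ⟨f, hf, g, hg, hx⟩ ⟨f', hf', g', hg', hy⟩
    refine ⟨f * f', F.mul_mem hf hf', g * g', G.mul_mem hg hg', ?_⟩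
    rw [mul_mul_mul_comm]
    exact mul_le_mul' hx hy
  mem_of_le := by
    rintro x y ⟨f, hf, g, hg, hx⟩ h
    exact ⟨f, hf, g, hg, hx.trans h⟩

theorem le_join_left (F G : Filt A) : F ≤ F.join G :=
  fun f hf => ⟨f, hf, 1, G.one_mem, mul_le_left _ _⟩

theorem le_join_right (F G : Filt A) : G ≤ F.join G :=
  fun g hg => ⟨1, F.one_mem, g, hg, mul_le_right _ _⟩

theorem isProper_iff {F : Filt A} : F.IsProper ↔ ⊥ ∉ F :=
  ⟨fun ⟨_, hx⟩ h => hx (F.mem_of_le h bot_le), fun h => ⟨⊥, h⟩⟩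

theorem exists_isMaximal_ge {F : Filt A} (hF : F.IsProper) : ∃ M : Filt A, M.IsMaximal ∧ F ≤ M := by
  obtain ⟨M, hFM, hM⟩ := zorn_le_nonempty₀ {G : Filt A | G.IsProper} (fun c hc hchain G₀ hG₀ => by
    refine ⟨{ carrier := {x | ∃ G ∈ c, x ∈ G}
              nonempty := ⟨1, G₀, hG₀, G₀.one_mem⟩
              mul_mem := ?_
              mem_of_le := fun ⟨G, hG, hx⟩ h => ⟨G, hG, G.mem_of_le hx h⟩ }, ?_,
      fun G hG x hx => ⟨G, hG, hx⟩⟩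
    · rintro x y ⟨G, hG, hx⟩ ⟨H, hH, hy⟩
      rcases hchain.total hG hH with h | h
      · exact ⟨H, hH, H.mul_mem (h hx) hy⟩
      · exact ⟨G, hG, G.mul_mem hx (h hy)⟩
    · exact isProper_iff.2 fun ⟨G, hG, h⟩ => isProper_iff.1 (hc hG) h) F hF
  exact ⟨M, hM, hFM⟩

end Filt

/-! ### Conormality of the reticulation. -/

theorem isConormalLattice_iff {L : Type*} [Lattice L] [BoundedOrder L] :
    IsConormalLattice L ↔
      ∀ x y : L, x ⊓ y = ⊥ → ∃ e f : L, e ⊔ f = ⊤ ∧ x ⊓ e = ⊥ ∧ y ⊓ f = ⊥ :=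
  Iff.rfl

section Conormal

variable {A : Type u} [ResiduatedLattice A]

theorem toRet_himp_inf_le (a b : A) : toRet a ⊓ toRet (a ⇨ b) ≤ toRet b := by
  rw [inf_comm]
  exact toRet_mono (himp_mul_le a b)

theorem isConormalLattice_of_prelinear (h : ∀ x y : A, (x ⇨ y) ⊔ (y ⇨ x) = 1) :
    IsConormalLattice (Reticulation A) := by
  refine isConormalLattice_iff.2 fun x y hxy => ?_
  induction x using ret_ind with | _ a
  induction y using ret_ind with | _ b
  refine ⟨toRet (a ⇨ b), toRet (b ⇨ a), congrArg toRet (h a b), ?_, ?_⟩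
  · exact le_bot_iff.1 ((le_inf inf_le_left (toRet_himp_inf_le a b)).trans hxy.le)
  · exact le_bot_iff.1 ((le_inf (toRet_himp_inf_le b a) inf_le_left).trans hxy.le)

theorem Filt.mem_principal_iff_toRet_le {a c : A} :
    c ∈ Filt.principal a ↔ toRet a ≤ toRet c :=
  toRet_le_iff.symm

theorem Filt.congr_r_iff {F : Filt A} {a b : A} : F.congr.r a b ↔ a ⇨ b ∈ F ∧ b ⇨ a ∈ F :=
  F.inf_mem_iff

theorem HasBLP.isConormalLattice (hA : HasBLP A) : IsConormalLattice (Reticulation A) := by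
  refine isConormalLattice_iff.2 fun x y hxy => ?_
  induction x using ret_ind with | _ a₀
  induction y using ret_ind with | _ b₀
  obtain ⟨n, hn⟩ : ∃ n : ℕ, (a₀ * b₀) ^ n ≤ ⊥ := toRet_le_iff.1 hxy.le
  -- Powers do not change the class in the reticulation, and they turn the nilpotent product into an
  -- actual zero.
  set a := a₀ ^ n
  set b := b₀ ^ n
  have hab : a * b = ⊥ := by rw [← mul_pow]; exact le_bot_iff.1 hn
  have ha : toRet a₀ ≤ toRet a := toRet_le_iff.2 ⟨n, le_rfl⟩
  have hb : toRet b₀ ≤ toRet b := toRet_le_iff.2 ⟨n, le_rfl⟩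
  -- The least filter modulo which `a ⊔ b` becomes `1`, hence `a` and `b` complementary.
  let F := Filt.principal (a ⊔ b)
  have hcompl : IsCompl (F.congr.proj a) (F.congr.proj b) := by
    refine isCompl_of_mul_eq_bot ?_ (congrArg F.congr.proj hab)
    refine F.congr.proj_eq_iff.2 (Filt.congr_r_iff.2 ⟨?_, ?_⟩)
    · rw [himp_eq_one_iff.2 (le_one' _)]
      exact F.one_mem
    · rw [one_himp]
      exact Filt.self_mem_principal _
  obtain ⟨e, ⟨f, hef⟩, he⟩ := hA F _ ⟨_, hcompl⟩
  obtain ⟨hea, hae⟩ := Filt.congr_r_iff.1 (F.congr.proj_eq_iff.1 he)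
  rw [Filt.mem_principal_iff_toRet_le, toRet_sup] at hea hae
  have hae' : toRet a ≤ toRet e :=
    (le_inf le_rfl (le_sup_left.trans hae)).trans (toRet_himp_inf_le a e)
  have hbe : toRet b ⊓ toRet e ≤ toRet a :=
    (le_inf inf_le_right (inf_le_left.trans (le_sup_right.trans hea))).trans
      (toRet_himp_inf_le e a)
  refine ⟨toRet f, toRet e, congrArg toRet hef.symm.sup_eq_one, ?_, ?_⟩
  · refine le_bot_iff.1 ((inf_le_inf_right _ (ha.trans hae')).trans ?_)
    exact (congrArg toRet hef.mul_eq_bot).le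
  · refine le_bot_iff.1 ((inf_le_inf_right _ hb).trans ((le_inf hbe inf_le_left).trans ?_))
    exact (congrArg toRet hab).le

theorem IsGelfand.isConormalLattice (hA : IsGelfand A) : IsConormalLattice (Reticulation A) := by
  refine isConormalLattice_iff.2 fun x y hxy => ?_
  by_contra hne
  -- The ideal generated by the annihilators of `x` and `y`; it contains `⊤` exactly when
  -- conormality witnesses exist.
  let I : Order.Ideal (Reticulation A) := Order.IsIdeal.toIdeal
    (I := {z | ∃ e f, x ⊓ e = ⊥ ∧ y ⊓ f = ⊥ ∧ z ≤ e ⊔ f})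
    { IsLowerSet := fun _ _ h ⟨e, f, he, hf, hz⟩ => ⟨e, f, he, hf, h.trans hz⟩
      Nonempty := ⟨⊥, ⊥, ⊥, inf_bot_eq _, inf_bot_eq _, bot_le⟩
      Directed := by
        rintro z ⟨e, f, he, hf, hz⟩ w ⟨e', f', he', hf', hw⟩
        refine ⟨z ⊔ w, ⟨e ⊔ e', f ⊔ f', ?_, ?_, ?_⟩, le_sup_left, le_sup_right⟩
        · rw [inf_sup_left, he, he', sup_idem]
        · rw [inf_sup_left, hf, hf', sup_idem]
        · exact (sup_le_sup hz hw).trans (sup_sup_sup_comm _ _ _ _).le }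
  have hdisj : Disjoint ((Order.PFilter.principal (⊤ : Reticulation A) : Order.PFilter _) : Set _)
      (I : Set (Reticulation A)) := by
    refine Set.disjoint_left.2 fun z hz ⟨e, f, he, hf, h⟩ => hne ⟨e, f, ?_, he, hf⟩
    exact top_le_iff.1 ((Order.PFilter.mem_principal.1 hz).trans h)
  obtain ⟨K, hK, hIK, hKtop⟩ := DistribLattice.prime_ideal_of_disjoint_filter_ideal hdisj
  have hxK : ∀ z, x ⊓ z = ⊥ → z ∈ K := fun z hz =>
    hIK ⟨z, ⊥, hz, inf_bot_eq _, le_sup_left⟩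
  have hyK : ∀ z, y ⊓ z = ⊥ → z ∈ K := fun z hz =>
    hIK ⟨⊥, z, inf_bot_eq _, hz, le_sup_right⟩
  let P : Filt A :=
    { carrier := {a | toRet a ∉ K}
      nonempty := ⟨1, fun h => Set.disjoint_left.1 hKtop (Order.PFilter.mem_principal.2 le_rfl) h⟩
      mul_mem := fun ha hb h => (hK.mem_or_mem h).elim ha hb
      mem_of_le := fun ha h hb => ha (K.lower (toRet_mono h) hb) }
  have hP : P.IsPrime := by
    refine ⟨⟨⊥, fun h => h K.bot_mem⟩, fun a b h => ?_⟩
    by_contra! hn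
    exact h (Order.Ideal.sup_mem (not_not.1 hn.1) (not_not.1 hn.2))
  have hmax : ∀ a : A, (∀ z, toRet a ⊓ z = ⊥ → z ∈ K) →
      ∃ M : Filt A, M.IsMaximal ∧ P ≤ M ∧ a ∈ M := by
    intro a ha
    -- If some `p ∈ P` and `c ∈ [a)` had product `⊥`, then `toRet p` would annihilate `toRet a` and
    -- so lie in `K`, contrary to `p ∈ P`.
    have hproper : (P.join (Filt.principal a)).IsProper := by
      rw [Filt.isProper_iff]
      rintro ⟨p, hp, c, hc, h⟩
      refine hp (ha _ (le_bot_iff.1 ?_))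
      rw [inf_comm]
      exact (inf_le_inf_left _ (Filt.mem_principal_iff_toRet_le.1 hc)).trans (toRet_mono h)
    obtain ⟨M, hM, hle⟩ := Filt.exists_isMaximal_ge hproper
    exact ⟨M, hM, (Filt.le_join_left _ _).trans hle,
      hle (Filt.le_join_right _ _ (Filt.self_mem_principal a))⟩
  induction x using ret_ind with | _ a
  induction y using ret_ind with | _ b
  obtain ⟨M, hM, hPM, haM⟩ := hmax a hxK
  obtain ⟨N, hN, hPN, hbN⟩ := hmax b hyK
  obtain rfl : M = N := (hA P hP).unique ⟨hM, hPM⟩ ⟨hN, hPN⟩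
  obtain ⟨n, hn⟩ : ∃ n : ℕ, (a * b) ^ n ≤ ⊥ := toRet_le_iff.1 hxy.le
  exact Filt.isProper_iff.1 hM.prop (M.mem_of_le (M.pow_mem (M.mul_mem haM hbN) n) hn)

end Conormal

/-! ### Congruences as filters, and complemented congruences. -/

namespace Congr

variable {A : Type u} [ResiduatedLattice A]

theorem proj_eq_one_iff (θ : Congr A) {a : A} : θ.proj a = 1 ↔ θ.r a 1 := θ.proj_eq_iff

/-- The filter `1/θ` of a congruence `θ`. -/
def filt (θ : Congr A) : Filt A where
  carrier := {a | θ.r a 1}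
  nonempty := ⟨1, θ.iseqv.refl 1⟩
  mul_mem := fun hx hy => by simpa using θ.mul hx hy
  mem_of_le := fun hx h => by
    rw [Set.mem_ofPred_eq, ← proj_eq_one_iff] at *
    exact eq_one_of_one_le (hx.ge.trans (θ.proj_mono h))

theorem mem_filt {θ : Congr A} {a : A} : a ∈ θ.filt ↔ θ.r a 1 := Iff.rfl

theorem r_iff_himp {θ : Congr A} {a b : A} : θ.r a b ↔ a ⇨ b ∈ θ.filt ∧ b ⇨ a ∈ θ.filt := by
  simp only [mem_filt, ← proj_eq_iff]
  change _ ↔ θ.proj a ⇨ θ.proj b = 1 ∧ θ.proj b ⇨ θ.proj a = 1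
  rw [himp_eq_one_iff, himp_eq_one_iff, le_antisymm_iff]

theorem filt_congr (θ : Congr A) : θ.filt.congr = θ :=
  ext fun _ _ => Filt.congr_r_iff.trans r_iff_himp.symm

theorem le_iff_filt_le {θ φ : Congr A} : θ ≤ φ ↔ θ.filt ≤ φ.filt :=
  ⟨fun h a ha => h a 1 ha, fun h _ _ hab =>
    r_iff_himp.2 ((r_iff_himp.1 hab).imp (@h _) (@h _))⟩

theorem congr_filt (F : Filt A) : F.congr.filt = F :=
  SetLike.ext fun a => by
    rw [mem_filt, Filt.congr_r_iff, himp_eq_one_iff.2 (le_one' a), one_himp]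
    exact and_iff_right F.one_mem

/-- The congruence generated by the pair `(a, 1)`. -/
def gen (a : A) : Congr A := (Filt.principal a).congr

theorem gen_le_iff {a : A} {θ : Congr A} : gen a ≤ θ ↔ θ.r a 1 := by
  rw [le_iff_filt_le, gen, congr_filt, Filt.principal_le_iff, mem_filt]

theorem gen_r (a : A) : (gen a).r a 1 := gen_le_iff.1 le_rfl

theorem eq_top_of_r_bot {θ : Congr A} (h : θ.r ⊥ 1) : θ = ⊤ := by
  refine top_le_iff.1 (le_iff_filt_le.2 fun a _ => ?_)
  exact θ.filt.mem_of_le (mem_filt.2 h) bot_le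

theorem filt_bot {a : A} : a ∈ (⊥ : Congr A).filt ↔ a = 1 := by
  refine ⟨fun h => ?_, fun h => h ▸ (⊥ : Congr A).iseqv.refl 1⟩
  -- Here `⊥` is the infimum of all congruences, so equality has to be exhibited as one of them.
  let Δ : Congr A :=
    { r := Eq
      iseqv := eq_equivalence
      sup := by rintro _ _ _ _ rfl rfl; rfl
      inf := by rintro _ _ _ _ rfl rfl; rfl
      mul := by rintro _ _ _ _ rfl rfl; rfl
      himp := by rintro _ _ _ _ rfl rfl; rfl }
  exact (bot_le : ⊥ ≤ Δ) a 1 h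

/-- An element of both filters is above `e ⊔ f = 1`, while a filter containing `e` and `f` contains
`e * f = ⊥`. -/
theorem isCompl_gen {e f : A} (h : IsCompl e f) : IsCompl (gen e) (gen f) := by
  constructor
  · intro θ he hf
    refine le_iff_filt_le.2 fun a ha => filt_bot.2 ?_
    have h₁ := le_iff_filt_le.1 he ha
    have h₂ := le_iff_filt_le.1 hf ha
    rw [gen, congr_filt, Filt.mem_principal_iff_of_isComplemented ⟨_, h⟩] at h₁
    rw [gen, congr_filt, Filt.mem_principal_iff_of_isComplemented ⟨_, h.symm⟩] at h₂
    exact eq_one_of_one_le (h.sup_eq_one.ge.trans (sup_le h₁ h₂))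
  · intro θ he hf
    rw [gen_le_iff] at he hf
    have := θ.filt.mul_mem (mem_filt.2 he) (mem_filt.2 hf)
    rw [h.mul_eq_bot] at this
    exact (eq_top_of_r_bot this).ge

/-- Let `δ` be a complement. Their filters generate all of `A`, so `⊥` factors as `e * f` across
them; they meet trivially, so any join across them is `1`. Hence `e` and `f` are complementary.
Every `a` in the filter of `γ` satisfies `a ⊔ f = 1` and `e * f = ⊥`, so `e ≤ a`. -/
theorem exists_eq_gen_of_isComplemented {γ : Congr A} (h : IsComplemented γ) :
    ∃ e : A, IsComplemented e ∧ γ = gen e := by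
  obtain ⟨δ, hd⟩ := h
  have htop : (γ.filt.join δ.filt).congr = ⊤ := by
    refine top_le_iff.1 (hd.sup_eq_top.ge.trans (sup_le ?_ ?_)) <;>
      rw [le_iff_filt_le, congr_filt]
    exacts [Filt.le_join_left _ _, Filt.le_join_right _ _]
  have hdisj : ∀ a b : A, a ∈ γ.filt → b ∈ δ.filt → a ⊔ b = 1 := fun a b ha hb => by
    rw [← filt_bot]
    have h₁ : gen (a ⊔ b) ≤ γ := gen_le_iff.2 (γ.filt.mem_of_le ha le_sup_left)
    have h₂ : gen (a ⊔ b) ≤ δ := gen_le_iff.2 (δ.filt.mem_of_le hb le_sup_right)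
    exact gen_le_iff.1 (hd.disjoint h₁ h₂)
  obtain ⟨e, he, f, hf, hef⟩ : ⊥ ∈ γ.filt.join δ.filt := by
    rw [← congr_filt (γ.filt.join δ.filt), htop]
    exact gen_le_iff.1 le_top
  have hef : e * f = ⊥ := le_bot_iff.1 hef
  refine ⟨e, ⟨f, isCompl_of_mul_eq_bot (hdisj e f he hf) hef⟩, le_antisymm ?_ (gen_le_iff.2 he)⟩
  refine le_iff_filt_le.2 fun a ha => ?_
  rw [gen, congr_filt]
  refine (Filt.principal e).mem_of_le (Filt.self_mem_principal e) ?_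
  exact le_of_sup_eq_one (hdisj a f ha hf) (mul_le_right _ _) (hef.le.trans bot_le)

/-- The inverse image of a congruence of `A/θ` under the canonical surjection. -/
def comap (θ : Congr A) (φ : Congr θ.Quo) : Congr A where
  r a b := φ.r (θ.proj a) (θ.proj b)
  iseqv := ⟨fun _ => φ.iseqv.refl _, fun h => φ.iseqv.symm h, fun h h' => φ.iseqv.trans h h'⟩
  sup h h' := φ.sup h h'
  inf h h' := φ.inf h h'
  mul h h' := φ.mul h h'
  himp h h' := φ.himp h h'

/-- This naturality identifies lifting complemented congruences with lifting complemented elements.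
For `≤`, the pullback of the right side to `A` contains both `θ` and the pair `(e, 1)`. -/
theorem u_gen (θ : Congr A) (e : A) : θ.u (gen e) = gen (θ.proj e) := by
  refine le_antisymm ?_ (gen_le_iff.2 ⟨e, 1, rfl, rfl, (le_sup_left : gen e ≤ _) e 1 (gen_r e)⟩)
  have hle : gen e ⊔ θ ≤ θ.comap (gen (θ.proj e)) := by
    refine sup_le (gen_le_iff.2 (gen_r (θ.proj e))) fun a b hab => ?_
    change (gen (θ.proj e)).r (θ.proj a) (θ.proj b)
    rw [θ.proj_eq_iff.2 hab]
  rintro _ _ ⟨a, b, rfl, rfl, hab⟩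
  exact hle a b hab

theorem gen_injOn {e f : A} (he : IsComplemented e) (hf : IsComplemented f)
    (h : gen e = gen f) : e = f := by
  have key : ∀ {e f : A}, IsComplemented e → gen e = gen f → e ≤ f := fun {e f} he h => by
    rw [← Filt.mem_principal_iff_of_isComplemented he, ← congr_filt (Filt.principal e)]
    exact gen_le_iff.1 h.ge
  exact le_antisymm (key he h) (key hf h.symm)

end Congr

theorem hasBLP_iff_hasCBLP (A : Type u) [ResiduatedLattice A] : HasBLP A ↔ HasCBLP A := by
  constructor
  · intro hA θ γ hγ
    obtain ⟨y, hy, rfl⟩ := Congr.exists_eq_gen_of_isComplemented hγ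
    obtain ⟨F, rfl⟩ : ∃ F : Filt A, θ = F.congr := ⟨_, θ.filt_congr.symm⟩
    obtain ⟨e, ⟨f, hef⟩, rfl⟩ := hA F y hy
    exact ⟨Congr.gen e, ⟨_, Congr.isCompl_gen hef⟩, Congr.u_gen _ e⟩
  · rintro hA F y ⟨z, hyz⟩
    obtain ⟨α, hα, hu⟩ := hA F.congr (Congr.gen y) ⟨_, Congr.isCompl_gen hyz⟩
    obtain ⟨e, he, rfl⟩ := Congr.exists_eq_gen_of_isComplemented hα
    refine ⟨e, he, Congr.gen_injOn ?_ ⟨z, hyz⟩ ((Congr.u_gen _ e).symm.trans hu)⟩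
    obtain ⟨f, hef⟩ := he
    refine ⟨F.congr.proj f, isCompl_of_mul_eq_bot ?_ ?_⟩
    · exact congrArg F.congr.proj hef.sup_eq_one
    · exact congrArg F.congr.proj hef.mul_eq_bot

end ResiduatedLattice

/-! ### A non-conormal lattice and the passage to classes. -/

open ResiduatedLattice

theorem isConormalLattice_of_orderIso {L M : Type*} [Lattice L] [BoundedOrder L] [Lattice M]
    [BoundedOrder M] (i : L ≃o M) (h : IsConormalLattice L) : IsConormalLattice M := by
  rw [isConormalLattice_iff] at *
  intro x y hxy
  obtain ⟨e, f, hef, hx, hy⟩ := h (i.symm x) (i.symm y) (by rw [← map_inf, hxy, map_bot])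
  refine ⟨i e, i f, by rw [← map_sup, hef, map_top], ?_, ?_⟩
  · simpa using congrArg i hx
  · simpa using congrArg i hy

theorem conormalBddDistLat_ne_top : conormalBddDistLat.{u} ≠ ⊤ := by
  intro h
  -- The two atoms are disjoint. Anything disjoint from an atom is not the new top, and the new top
  -- is not a join of two smaller elements.
  let L := WithTop (Set (ULift.{u} Bool))
  have hL : IsConormalLattice L := by
    have : conormalBddDistLat (BddDistLat.of L) := h ▸ trivial
    exact this
  rw [isConormalLattice_iff] at hL
  let s : Bool → Set (ULift.{u} Bool) := fun i => {⟨i⟩}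
  have hs : (s true : L) ⊓ (s false : L) = ⊥ := by
    rw [← WithTop.coe_inf]
    refine congrArg WithTop.some (Set.eq_empty_of_forall_notMem ?_)
    rintro _ ⟨rfl, h⟩
    simp [s] at h
  obtain ⟨e, f, hef, he, hf⟩ := hL _ _ hs
  have hne : ∀ i (z : L), (s i : L) ⊓ z = ⊥ → z ≠ ⊤ := by
    rintro i z hz rfl
    rw [inf_top_eq] at hz
    exact Set.singleton_ne_empty _ (WithTop.coe_injective hz)
  lift e to Set (ULift.{u} Bool) using hne _ _ he
  lift f to Set (ULift.{u} Bool) using hne _ _ hf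
  exact WithTop.coe_ne_top hef

theorem map_reticulation_le_and_ne_top {P : ObjectProperty ResLat.{u}}
    (hP : ∀ A : ResLat.{u}, P A → IsConormalLattice (Reticulation A)) :
    P.map ResLat.reticulation ≤ conormalBddDistLat ∧ P.map ResLat.reticulation ≠ ⊤ := by
  have hle : P.map ResLat.reticulation ≤ conormalBddDistLat := by
    -- The image of a class is closed under isomorphism, so conormality must be carried along `i`.
    rintro L ⟨A, hA, ⟨i⟩⟩
    refine isConormalLattice_of_orderIso (L := Reticulation A) (M := L) ?_ (hP A hA)
    exact Equiv.toOrderIso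
      ⟨i.hom.hom, i.inv.hom, BddDistLat.inv_hom_apply i, BddDistLat.hom_inv_apply i⟩
      (OrderHomClass.mono i.hom.hom) (OrderHomClass.mono i.inv.hom)
  exact ⟨hle, fun h => conormalBddDistLat_ne_top (top_le_iff.1 (h ▸ hle))⟩

theorem mainTheorem12 :
    (ResLat.gelfand.{u}.map ResLat.reticulation ≤ conormalBddDistLat ∧
      ResLat.gelfand.{u}.map ResLat.reticulation ≠ ⊤) ∧
    (ResLat.blp.{u}.map ResLat.reticulation ≤ conormalBddDistLat ∧
      ResLat.blp.{u}.map ResLat.reticulation ≠ ⊤) ∧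
    (ResLat.cblp.{u}.map ResLat.reticulation ≤ conormalBddDistLat ∧
      ResLat.cblp.{u}.map ResLat.reticulation ≠ ⊤) ∧
    ResLat.blp.{u} = ResLat.cblp.{u} ∧
    (ResLat.blAlgebra.{u}.map ResLat.reticulation ≤ conormalBddDistLat ∧
      ResLat.blAlgebra.{u}.map ResLat.reticulation ≠ ⊤) ∧
    (ResLat.mvAlgebra.{u}.map ResLat.reticulation ≤ conormalBddDistLat ∧
      ResLat.mvAlgebra.{u}.map ResLat.reticulation ≠ ⊤) := by
  refine ⟨map_reticulation_le_and_ne_top fun _ h => IsGelfand.isConormalLattice h,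
    map_reticulation_le_and_ne_top fun _ h => HasBLP.isConormalLattice h,
    map_reticulation_le_and_ne_top fun A h =>
      HasBLP.isConormalLattice ((hasBLP_iff_hasCBLP A).2 h),
    funext fun A => propext (hasBLP_iff_hasCBLP A),
    map_reticulation_le_and_ne_top fun _ h => isConormalLattice_of_prelinear h.2,
    map_reticulation_le_and_ne_top fun _ h => isConormalLattice_of_prelinear h.prelinear⟩
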